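/- **Setting.** Let $N$ users have request probabilities $q_i\in(0,1]$, let $p\in(0,1]$ be the content update probability, and let $C_f\in\mathbb R$ be the common fetch cost. The age cost of user $i$ is a nonnegative, increasing (nondecreasing and not constant), convex function $C_{a_i}:\mathbb N\to\mathbb R$, and $\bar C_{av,i}(\tau)=\mathbb E[C_{a_i}(V)]$ with $V\sim\mathrm{Binomial}(\tau,p)$. A cost split is a vector $\alpha$ with $\alpha_i>0$ and $\sum_{i=1}^N\alpha_i=1$. For $\lambda\in\mathbb R$, the single-user problem of user $i$ is the average-cost Markov decision process with states $(\tau,s)$, $\tau\in\{1,2,\dots\}$, $s\in\{0,1\}$, actions $a\in\{0,1\}$ ($1$ = fetch), one-slot cost $$c^\lambda_i(\tau,s,a)=(\alpha_iC_f+\lambda)\,a+(1-a)\,s\,\bar C_{av,i}(\tau),$$ and transitions $(\tau,s)\mapsto(1,s')$ if $a=1$ and $(\tau,s)\mapsto(\tau+1,s')$ if $a=0$, where $s'\sim\mathrm{Bernoulli}(q_i)$ is independent of the past. Let $\theta$ be its optimal long-run average expected cost, the infimum over all history-dependent (randomized) policies, and let $h$ be a bounded relative cost function, i.e. a bounded solution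 of the Bellman equation $$h(\tau,s)+\theta=\min_{a}\big\{c_i^\lambda(\tau,s,a)+\mathbb E[h(\tau',s')]\big\}.$$ An action is optimal in a state if it attains this minimum; an optimal policy $\pi^*$ takes an optimal action in every state. The passive set $\mathcal P^i(\lambda)$ is the set of states in which action $0$ is optimal, and the Whittle index is $W^i(\tau,s)=\min\{\lambda:(\tau,s)\in\mathcal P^i(\lambda)\}$. For $\mu\in\mathbb R$ let $$f_i(\mu)=\operatorname*{arg\,min}_{\tau\ge1}\frac{q_i\sum_{x=1}^{\tau-1}\bar C_{av,i}(x)+\mu}{\tau+\frac{1-q_i}{q_i}}$$ (the largest minimizer), and for $\tau\geq 1$ let $g_i(\tau)=\min\{\mu\in\mathbb R:f_i(\mu)>\tau\}$. **Lemma.** 0. The function $f_i$ is well defined (there is a largest minimizer for every $\mu$), and the minimum that defines $g_i(\tau)$ is attained. If $f_i$ is replaced by any other choice of a minimizer for each $\mu$, then $g_i(\tau)$ is the infimum of the corresponding set. 1. For every cost split $\alpha$ and every user $i$: an optimal policy exists for every $\lambda$, the minimum that defines $W^i(\tau,s)$ is attained, and for all $\tau\ge1$ $$W^i(\tau,1)=g_i(\tau)-\alpha_iC_f,\qquad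 W^i(\tau,0)=-\alpha_iC_f.$$ Moreover, for every choice of an optimal policy $\pi^*_\lambda$ for each $\lambda$ (that is, for every way to break ties), $W^i(\tau,s)=\inf\{\lambda:\pi^*_\lambda(\tau,s)=0\}$. 2. For all $\tau\ge1$ and $s\in\{0,1\}^N$, the sum $\sum_{i=1}^NW^i(\tau,s_i)$ is the same for all cost splits $\alpha$. Consequently the Whittle index policy, which fetches in state $(\tau,s)$ if and only if $\sum_{i=1}^NW^i(\tau,s_i)>0$ and $\sum_{i=1}^Ns_i>0$, does not depend on $\alpha$. -/

import Mathlib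

namespace WhittleAge

/-- A state `(τ, s)` of a single user: `τ ≥ 1` is the time since the last fetch, and `s` tells
whether the user requests the content in the current slot. -/
abbrev UserState := ℕ+ × Bool

/-- Expected age cost `E[C(V)]` for `V ∼ Binomial(τ, p)`. -/
noncomputable def avgAgeCost (p : ℝ) (C : ℕ → ℝ) (τ : ℕ) : ℝ :=
  ∑ k ∈ Finset.range (τ + 1), (τ.choose k : ℝ) * p ^ k * (1 - p) ^ (τ - k) * C k

/-- A single user of request probability `q`, expected age cost `Cav τ` and fetch cost `κ`
(the share `α_i C_f` of the common fetch cost). -/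
structure User where
  κ : ℝ
  q : ℝ
  Cav : ℕ → ℝ

namespace User

variable (U : User)

/-- One-slot cost of the single-user problem with multiplier `l`: `κ a + (1 - a) s Cav(τ) + l a`.
The action `a = true` is "fetch", `a = false` is "do not fetch" (passive). -/
noncomputable def stageCost (l : ℝ) (x : UserState) (a : Bool) : ℝ :=
  if a then U.κ + l else if x.2 then U.Cav x.1 else 0

/-- Time since the last fetch in the next slot. -/
def nextAge (τ : ℕ+) (a : Bool) : ℕ+ := if a then 1 else τ + 1

/-- Expectation of `φ (τ', s')` over the next state: `τ'` is determined by the action, and the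
request `s'` is Bernoulli(`q`), independent of the past. -/
noncomputable def expectNext (x : UserState) (a : Bool) (φ : UserState → ℝ) : ℝ :=
  U.q * φ (nextAge x.1 a, true) + (1 - U.q) * φ (nextAge x.1 a, false)

/-- History-dependent randomized policies: the probability of fetching, given the list of past
state-action pairs (most recent first) and the current state. -/
abbrev Policy := List (UserState × Bool) → UserState → unitInterval

/-- Expected total cost of a policy over the next `T` slots, given the past and the current
state. -/
noncomputable def expectedCost (l : ℝ) (π : Policy) :
    ℕ → List (UserState × Bool) → UserState → ℝ
  | 0, _, _ => 0
  | T + 1, H, x =>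
      (π H x : ℝ) * (U.stageCost l x true +
          U.expectNext x true (fun y => expectedCost l π T ((x, true) :: H) y)) +
        (1 - (π H x : ℝ)) * (U.stageCost l x false +
          U.expectNext x false (fun y => expectedCost l π T ((x, false) :: H) y))

/-- Long-run average expected cost of a policy from the initial state `x`. -/
noncomputable def averageCost (l : ℝ) (π : Policy) (x : UserState) : EReal :=
  Filter.limsup (fun T : ℕ => ((U.expectedCost l π T [] x / T : ℝ) : EReal)) Filter.atTop

/-- Optimal long-run average expected cost from the initial state `x`. -/
noncomputable def optimalCost (l : ℝ) (x : UserState) : EReal :=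
  ⨅ π : Policy, U.averageCost l π x

/-- The term of the Bellman equation that belongs to action `a` in state `x`. -/
noncomputable def actionValue (l : ℝ) (h : UserState → ℝ) (x : UserState) (a : Bool) : ℝ :=
  U.stageCost l x a + U.expectNext x a h

/-- `h` is a (bounded) relative cost function of the average-cost problem: together with the
optimal average cost `θ`, the same for all initial states, it solves the Bellman equation. -/
structure IsRelativeCost (l θ : ℝ) (h : UserState → ℝ) : Prop where
  optimal : ∀ x, U.optimalCost l x = (θ : EReal)
  bounded : ∃ B : ℝ, ∀ x, |h x| ≤ B
  bellman : ∀ x, h x + θ = min (U.actionValue l h x true) (U.actionValue l h x false)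

/-- `π` takes in every state an optimal action: one that attains the minimum in the Bellman
equation. -/
def IsOptimalPolicy (l : ℝ) (π : UserState → Bool) : Prop :=
  ∃ θ h, U.IsRelativeCost l θ h ∧
    ∀ x, U.actionValue l h x (π x) =
      min (U.actionValue l h x true) (U.actionValue l h x false)

/-- The passive set: the states in which not fetching is an optimal action. -/
def passiveSet (l : ℝ) : Set UserState :=
  {x | ∃ π, U.IsOptimalPolicy l π ∧ π x = false}

/-- The Whittle index of a state. -/
noncomputable def whittleIndex (x : UserState) : ℝ :=
  sInf {l : ℝ | x ∈ U.passiveSet l}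

end User

/-- The ratio `(q ∑_{x=1}^{τ-1} Cav(x) + m) / (τ + (1 - q) / q)`. -/
noncomputable def thresholdRatio (q : ℝ) (Cav : ℕ → ℝ) (m : ℝ) (τ : ℕ) : ℝ :=
  (q * ∑ x ∈ Finset.Ico 1 τ, Cav x + m) / (τ + (1 - q) / q)

/-- The minimizers over `τ ≥ 1` of the ratio. -/
def thresholdArgmin (q : ℝ) (Cav : ℕ → ℝ) (m : ℝ) : Set ℕ :=
  {τ | 1 ≤ τ ∧ ∀ σ : ℕ, 1 ≤ σ → thresholdRatio q Cav m τ ≤ thresholdRatio q Cav m σ}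

/-- The function `f`: the (largest) minimizer of the ratio. -/
noncomputable def threshold (q : ℝ) (Cav : ℕ → ℝ) (m : ℝ) : ℕ :=
  sSup (thresholdArgmin q Cav m)

/-- The generalized inverse `g(τ) = min {m | f(m) > τ}` of `f`. -/
noncomputable def thresholdInv (q : ℝ) (Cav : ℕ → ℝ) (τ : ℕ) : ℝ :=
  sInf {m : ℝ | τ < threshold q Cav m}

/-- Age cost functions: nonnegative, increasing (not constant) and convex on `ℕ`. -/
structure IsAgeCost (C : ℕ → ℝ) : Prop where
  nonneg : ∀ n, 0 ≤ C n
  mono : Monotone C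
  nonconst : ∃ n, C 0 < C n
  convex : ∀ n, 2 * C (n + 1) ≤ C n + C (n + 2)

/-- A split of the fetch cost among the users. -/
def IsCostSplit {N : ℕ} (α : Fin N → ℝ) : Prop :=
  (∀ i, 0 < α i) ∧ ∑ i, α i = 1

/-- The `i`-th user of the system, whose share of the fetch cost `Cf` is `α i * Cf`. -/
noncomputable def user {N : ℕ} (p Cf : ℝ) (q : Fin N → ℝ) (C : Fin N → ℕ → ℝ) (α : Fin N → ℝ)
    (i : Fin N) : User :=
  ⟨α i * Cf, q i, avgAgeCost p (C i)⟩

open Classical in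
/-- The Whittle index policy: fetch iff the sum of the Whittle indices is positive and there is
at least one request. -/
noncomputable def whittlePolicy {N : ℕ} (U : Fin N → User) (τ : ℕ+) (s : Fin N → Bool) : Bool :=
  decide (0 < ∑ i, (U i).whittleIndex (τ, s i) ∧ ∃ i, s i = true)

end WhittleAge

/-!
Fix a user with request probability `q` and expected age cost `c`, and let `m = κ + l` be the total
charge for a fetch. If `m < 0`, fetching in every slot is optimal. If `m ≥ 0`, waiting is optimal in
every slot without a request, and a policy that fetches at the first request from age `τ` on has
average cost `thresholdRatio q c m τ`, by renewal.

Everything is explicit in terms of the number `criticalCharge q c τ`, the charge at which the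
thresholds `τ` and `τ + 1` are equally good. The ratio at `τ + 1` is at most the ratio at `τ` if and
only if `criticalCharge q c τ ≤ m`. Since `c` is nondecreasing and unbounded, so is the critical
charge; hence the ratio is unimodal in the threshold, its largest minimizer exceeds `τ` if and only
if `criticalCharge q c τ ≤ m`, and the generalized inverse of the threshold is the critical charge.
Ties between minimizers occur only for `m` equal to some critical charge, so that other choices of
minimizers give the same infimum.

For the decision problem, `thresholdCost` is a bounded solution of the Bellman equation if `m ≥ 0`,
and the constant `0` is one if `m < 0`. A bounded solution certifies the optimal average cost over
all history-dependent randomized policies (`User.optimalCost_eq_of_bellman`). The notion of an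
optimal action refers to any bounded solution, so uniqueness up to a constant is needed
(`User.meanCost_sub_eq`): at high ages the Bellman recursion from one age back to the preceding one
contracts by `1 - q`, so that bounded solutions agree there, and it then determines the solution at
lower ages.
Comparing the two actions for the explicit solution shows that waiting is optimal in `(τ, 1)` if and
only if `criticalCharge q c τ ≤ m`, and in `(τ, 0)` if and only if `0 ≤ m`, with ties only at
equality (`User.exists_isRelativeCost`). The Whittle index is thus the critical charge, or `0`,
minus `κ = α C_f`; in the sum over the users the shares `α` add up to one.
-/

open Filter Topology

namespace WhittleAge

/-! ### The expected age cost -/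

/-- Conditioning on the last of the `n + 1` trials. -/
theorem avgAgeCost_succ (p : ℝ) (C : ℕ → ℝ) (n : ℕ) :
    avgAgeCost p C (n + 1) =
      (1 - p) * avgAgeCost p C n + p * avgAgeCost p (fun k => C (k + 1)) n := by
  have hlast : (1 - p) * avgAgeCost p C n =
      ∑ k ∈ Finset.range (n + 2), (n.choose k : ℝ) * p ^ k * (1 - p) ^ (n + 1 - k) * C k := by
    rw [Finset.sum_range_succ, Nat.choose_eq_zero_of_lt (Nat.lt_succ_self n), avgAgeCost,
      Finset.mul_sum]
    simp only [Nat.cast_zero, zero_mul, add_zero]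
    refine Finset.sum_congr rfl fun k hk => ?_
    rw [Nat.succ_sub (Nat.lt_succ_iff.mp (Finset.mem_range.mp hk)), pow_succ]
    ring
  rw [hlast, avgAgeCost, avgAgeCost, Finset.mul_sum, Finset.sum_range_succ',
    Finset.sum_range_succ' (n := n + 1), add_right_comm, ← Finset.sum_add_distrib]
  congr 1
  · refine Finset.sum_congr rfl fun k _ => ?_
    rw [Nat.choose_succ_succ, Nat.add_sub_add_right]
    push_cast
    ring
  · simp

theorem avgAgeCost_mono {p : ℝ} (hp0 : 0 ≤ p) (hp1 : p ≤ 1) {C C' : ℕ → ℝ}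
    (h : ∀ k, C k ≤ C' k) (n : ℕ) : avgAgeCost p C n ≤ avgAgeCost p C' n := by
  have := sub_nonneg.mpr hp1
  exact Finset.sum_le_sum fun k _ => mul_le_mul_of_nonneg_left (h k) (by positivity)

/-- The mean of an affine function of a binomial variable. -/
theorem avgAgeCost_affine (p a b : ℝ) (n : ℕ) :
    avgAgeCost p (fun k => a * k + b) n = a * (n * p) + b := by
  induction n generalizing b with
  | zero => simp [avgAgeCost]
  | succ n ih =>
    have hshift : (fun k : ℕ => a * ((k + 1 : ℕ) : ℝ) + b) = fun k : ℕ => a * k + (a + b) := by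
      funext k
      push_cast
      ring
    rw [avgAgeCost_succ, ih, hshift, ih]
    push_cast
    ring

theorem monotone_avgAgeCost {p : ℝ} (hp0 : 0 ≤ p) (hp1 : p ≤ 1) {C : ℕ → ℝ} (hC : Monotone C) :
    Monotone (avgAgeCost p C) := by
  refine monotone_nat_of_le_succ fun n => ?_
  have h := avgAgeCost_mono hp0 hp1 (fun k => hC (Nat.le_succ k)) n
  rw [avgAgeCost_succ]
  nlinarith [mul_le_mul_of_nonneg_left h hp0]

theorem avgAgeCost_nonneg {p : ℝ} (hp0 : 0 ≤ p) (hp1 : p ≤ 1) {C : ℕ → ℝ} (hC : ∀ n, 0 ≤ C n)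
    (n : ℕ) : 0 ≤ avgAgeCost p C n := by
  have := sub_nonneg.mpr hp1
  exact Finset.sum_nonneg fun k _ => mul_nonneg (by positivity) (hC k)

/-- A convex function that is not constant grows at least linearly: its increments are
nondecreasing, and one of them is positive. -/
theorem IsAgeCost.exists_affine_le {C : ℕ → ℝ} (hC : IsAgeCost C) :
    ∃ a b : ℝ, 0 < a ∧ ∀ n : ℕ, a * n + b ≤ C n := by
  obtain ⟨k, hk⟩ : ∃ k, C k < C (k + 1) := by
    by_contra! h
    obtain ⟨n, hn⟩ := hC.nonconst
    exact absurd (antitone_nat_of_succ_le h (Nat.zero_le n)) (not_le.mpr hn)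
  have hincr : Monotone fun n => C (n + 1) - C n :=
    monotone_nat_of_le_succ fun n => by linarith [hC.convex n]
  refine ⟨C (k + 1) - C k, -((C (k + 1) - C k) * k), sub_pos.mpr hk, fun n => ?_⟩
  rcases le_total n k with h | h
  · have : (n : ℝ) ≤ k := by exact_mod_cast h
    nlinarith [hC.nonneg n, sub_pos.mpr hk]
  · induction n, h using Nat.le_induction with
    | base => linarith [hC.nonneg k]
    | succ n hn ih =>
      have := hincr hn
      simp only at this
      push_cast
      linarith

theorem IsAgeCost.tendsto_avgAgeCost {p : ℝ} (hp0 : 0 < p) (hp1 : p ≤ 1) {C : ℕ → ℝ}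
    (hC : IsAgeCost C) : Filter.Tendsto (avgAgeCost p C) Filter.atTop Filter.atTop := by
  obtain ⟨a, b, ha, hab⟩ := hC.exists_affine_le
  refine Filter.tendsto_atTop_mono
    (fun n => (avgAgeCost_affine p a b n).symm.le.trans (avgAgeCost_mono hp0.le hp1 hab n)) ?_
  exact Filter.tendsto_atTop_add_const_right _ _
    ((tendsto_natCast_atTop_atTop.atTop_mul_const hp0).const_mul_atTop ha)

/-! ### The minimizers of the threshold ratio -/

/-- What the theory of the single-user problem uses of the request probability `q` and the expected
age cost `c`. -/
structure Admissible (q : ℝ) (c : ℕ → ℝ) : Prop where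
  q_pos : 0 < q
  q_le_one : q ≤ 1
  nonneg : ∀ n, 0 ≤ c n
  mono : Monotone c
  tendsto : Filter.Tendsto c Filter.atTop Filter.atTop

/-- The value of `m` at which the thresholds `τ` and `τ + 1` give the same ratio. -/
noncomputable def criticalCharge (q : ℝ) (c : ℕ → ℝ) (τ : ℕ) : ℝ :=
  q * c τ * (τ + (1 - q) / q) - q * ∑ x ∈ Finset.Ico 1 τ, c x

theorem criticalCharge_succ_sub (q : ℝ) (c : ℕ → ℝ) {n : ℕ} (hn : 1 ≤ n) :
    criticalCharge q c (n + 1) - criticalCharge q c n =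
      q * (c (n + 1) - c n) * (n + 1 + (1 - q) / q) := by
  rw [criticalCharge, criticalCharge, Finset.sum_Ico_succ_top hn]
  push_cast
  ring

namespace Admissible

variable {q : ℝ} {c : ℕ → ℝ}

theorem length_pos (hA : Admissible q c) {n : ℕ} (hn : 1 ≤ n) : (0 : ℝ) < n + (1 - q) / q := by
  have h1 := div_nonneg (sub_nonneg.mpr hA.q_le_one) hA.q_pos.le
  have h2 : (1 : ℝ) ≤ n := by exact_mod_cast hn
  linarith

theorem criticalCharge_mono (hA : Admissible q c) {n k : ℕ} (hn : 1 ≤ n) (hnk : n ≤ k) :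
    criticalCharge q c n ≤ criticalCharge q c k := by
  induction k, hnk using Nat.le_induction with
  | base => exact le_rfl
  | succ k hk ih =>
    have h1 := criticalCharge_succ_sub q c (hn.trans hk)
    have h2 := hA.length_pos (hn.trans hk)
    have h3 := sub_nonneg.mpr (hA.mono k.le_succ)
    have h4 : 0 ≤ q * (c (k + 1) - c k) * (k + 1 + (1 - q) / q) :=
      mul_nonneg (mul_nonneg hA.q_pos.le h3) (by linarith)
    linarith

theorem criticalCharge_nonneg (hA : Admissible q c) {n : ℕ} (hn : 1 ≤ n) :
    0 ≤ criticalCharge q c n := by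
  refine le_trans ?_ (hA.criticalCharge_mono le_rfl hn)
  have := hA.length_pos le_rfl
  simp only [criticalCharge, Finset.Ico_self, Finset.sum_empty, mul_zero, sub_zero]
  exact mul_nonneg (mul_nonneg hA.q_pos.le (hA.nonneg 1)) this.le

theorem le_criticalCharge (hA : Admissible q c) {n : ℕ} (hn : 1 ≤ n) :
    q * (c n - c 1) ≤ criticalCharge q c n := by
  induction n, hn using Nat.le_induction with
  | base => simpa using hA.criticalCharge_nonneg le_rfl
  | succ k hk ih =>
    have h1 := criticalCharge_succ_sub q c hk
    have h2 := hA.length_pos hk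
    have h3 := mul_nonneg hA.q_pos.le (sub_nonneg.mpr (hA.mono k.le_succ))
    nlinarith [mul_nonneg h3 h2.le]

theorem exists_lt_criticalCharge (hA : Admissible q c) (m : ℝ) :
    ∃ n, 1 ≤ n ∧ m < criticalCharge q c n := by
  obtain ⟨n, hn1, hn⟩ := ((Filter.eventually_ge_atTop 1).and
    (hA.tendsto.eventually_gt_atTop (m / q + c 1))).exists
  refine ⟨n, hn1, lt_of_lt_of_le ?_ (hA.le_criticalCharge hn1)⟩
  rw [mul_comm, ← div_lt_iff₀ hA.q_pos]
  linarith

theorem thresholdRatio_sub_succ (hA : Admissible q c) (m : ℝ) {n : ℕ} (hn : 1 ≤ n) :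
    (thresholdRatio q c m n - thresholdRatio q c m (n + 1)) *
        ((n + (1 - q) / q) * (n + 1 + (1 - q) / q)) = m - criticalCharge q c n := by
  have h1 := hA.length_pos hn
  have h2 : (0 : ℝ) < n + 1 + (1 - q) / q := by linarith
  simp only [thresholdRatio, criticalCharge, Finset.sum_Ico_succ_top hn]
  push_cast
  rw [add_right_comm] at h2 ⊢
  generalize (n : ℝ) + (1 - q) / q = a at *
  field_simp
  ring

theorem thresholdRatio_succ_le (hA : Admissible q c) {m : ℝ} {n : ℕ} (hn : 1 ≤ n)
    (h : criticalCharge q c n ≤ m) :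
    thresholdRatio q c m (n + 1) ≤ thresholdRatio q c m n := by
  have h1 := hA.length_pos hn
  have h2 : (0 : ℝ) < n + 1 + (1 - q) / q := by linarith
  have h3 := hA.thresholdRatio_sub_succ m hn
  exact sub_nonneg.mp (nonneg_of_mul_nonneg_left (h3 ▸ sub_nonneg.mpr h) (mul_pos h1 h2))

theorem thresholdRatio_succ_lt (hA : Admissible q c) {m : ℝ} {n : ℕ} (hn : 1 ≤ n)
    (h : criticalCharge q c n < m) :
    thresholdRatio q c m (n + 1) < thresholdRatio q c m n := by
  have h1 := hA.length_pos hn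
  have h2 : (0 : ℝ) < n + 1 + (1 - q) / q := by linarith
  have h3 := hA.thresholdRatio_sub_succ m hn
  exact sub_pos.mp (pos_of_mul_pos_left (h3 ▸ sub_pos.mpr h) (mul_pos h1 h2).le)

theorem thresholdRatio_lt_succ (hA : Admissible q c) {m : ℝ} {n : ℕ} (hn : 1 ≤ n)
    (h : m < criticalCharge q c n) :
    thresholdRatio q c m n < thresholdRatio q c m (n + 1) := by
  have h1 := hA.length_pos hn
  have h2 : (0 : ℝ) < n + 1 + (1 - q) / q := by linarith
  have h3 := hA.thresholdRatio_sub_succ m hn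
  refine sub_neg.mp (neg_of_mul_neg_left (h3 ▸ sub_neg.mpr h) (mul_pos h1 h2).le)

/-- The ratio decreases while the critical charge is at most `m` and strictly increases from then
on, so its largest minimizer is the first `n` with `m < criticalCharge q c n`. -/
theorem exists_isGreatest_thresholdArgmin (hA : Admissible q c) (m : ℝ) :
    ∃ t, IsGreatest (thresholdArgmin q c m) t ∧
      ∀ n, 1 ≤ n → (n < t ↔ criticalCharge q c n ≤ m) := by
  classical
  have hex := hA.exists_lt_criticalCharge m
  obtain ⟨ht1, ht⟩ := Nat.find_spec hex
  set t := Nat.find hex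
  have hiff : ∀ n, 1 ≤ n → (n < t ↔ criticalCharge q c n ≤ m) := fun n hn =>
    ⟨fun h => not_lt.mp fun h' => Nat.find_min hex h ⟨hn, h'⟩,
      fun h => not_le.mp fun h' => not_lt.mpr h (ht.trans_le (hA.criticalCharge_mono ht1 h'))⟩
  have hright : ∀ n, t < n → thresholdRatio q c m t < thresholdRatio q c m n := by
    intro n hn
    induction n, hn using Nat.le_induction with
    | base => exact hA.thresholdRatio_lt_succ ht1 ht
    | succ n hn ih =>
      have htn : t ≤ n := (Nat.le_succ t).trans hn
      exact ih.trans (hA.thresholdRatio_lt_succ (ht1.trans htn)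
        (ht.trans_le (hA.criticalCharge_mono ht1 htn)))
  have hleft : ∀ n, 1 ≤ n → n ≤ t → thresholdRatio q c m t ≤ thresholdRatio q c m n := by
    intro n hn hnt
    induction hnt using Nat.decreasingInduction with
    | self => exact le_rfl
    | of_succ n hnt ih =>
      exact (ih (Nat.le_succ_of_le hn)).trans
        (hA.thresholdRatio_succ_le hn ((hiff n hn).mp hnt))
  refine ⟨t, ⟨⟨ht1, fun n hn => ?_⟩, fun n hn => ?_⟩, hiff⟩
  · exact (le_total n t).elim (hleft n hn) fun h =>
      h.eq_or_lt.elim (fun h => h ▸ le_rfl) fun h => (hright n h).le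
  · exact not_lt.mp fun h => not_le.mpr (hright n h) (hn.2 t ht1)

theorem isGreatest_threshold (hA : Admissible q c) (m : ℝ) :
    IsGreatest (thresholdArgmin q c m) (threshold q c m) := by
  obtain ⟨t, ht, -⟩ := hA.exists_isGreatest_thresholdArgmin m
  rwa [threshold, ht.csSup_eq]

theorem lt_threshold_iff (hA : Admissible q c) {m : ℝ} {n : ℕ} (hn : 1 ≤ n) :
    n < threshold q c m ↔ criticalCharge q c n ≤ m := by
  obtain ⟨t, ht, hiff⟩ := hA.exists_isGreatest_thresholdArgmin m
  rw [threshold, ht.csSup_eq, hiff n hn]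

theorem setOf_lt_threshold (hA : Admissible q c) {n : ℕ} (hn : 1 ≤ n) :
    {m : ℝ | n < threshold q c m} = Set.Ici (criticalCharge q c n) :=
  Set.ext fun _ => hA.lt_threshold_iff hn

theorem thresholdInv_eq (hA : Admissible q c) {n : ℕ} (hn : 1 ≤ n) :
    thresholdInv q c n = criticalCharge q c n := by
  rw [thresholdInv, hA.setOf_lt_threshold hn, csInf_Ici]

theorem lt_of_mem_thresholdArgmin (hA : Admissible q c) {m : ℝ} {n t : ℕ}
    (h : criticalCharge q c n < m) (ht : t ∈ thresholdArgmin q c m) : n < t := by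
  by_contra! htn
  exact not_le.mpr (hA.thresholdRatio_succ_lt ht.1 ((hA.criticalCharge_mono ht.1 htn).trans_lt h))
    (ht.2 _ (Nat.le_succ_of_le ht.1))

end Admissible

/-- A set between an open and a closed upper ray has the common end point as infimum. -/
theorem isGLB_of_Ioi_subset_of_subset_Ici {a : ℝ} {s : Set ℝ} (h1 : Set.Ioi a ⊆ s)
    (h2 : s ⊆ Set.Ici a) : IsGLB s a :=
  ⟨fun _ hx => h2 hx, fun _ hb => isGLB_Ioi.2 fun _ hx => hb (h1 hx)⟩

namespace User

variable (U : User)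

/-! ### Verification of the Bellman equation -/

theorem expectNext_mono (hq0 : 0 ≤ U.q) (hq1 : U.q ≤ 1) (x : UserState) (a : Bool)
    {φ ψ : UserState → ℝ} (h : ∀ y, φ y ≤ ψ y) : U.expectNext x a φ ≤ U.expectNext x a ψ :=
  add_le_add (mul_le_mul_of_nonneg_left (h _) hq0)
    (mul_le_mul_of_nonneg_left (h _) (sub_nonneg.mpr hq1))

theorem expectNext_const_add (x : UserState) (a : Bool) (b : ℝ) (φ : UserState → ℝ) :
    U.expectNext x a (fun y => b + φ y) = b + U.expectNext x a φ := by
  simp only [expectNext]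
  ring

theorem le_expectedCost (hq0 : 0 ≤ U.q) (hq1 : U.q ≤ 1) {l θ B : ℝ} {h : UserState → ℝ}
    (hB : ∀ x, h x ≤ B)
    (hbell : ∀ x a, h x + θ ≤ U.actionValue l h x a) (π : Policy) (T : ℕ)
    (H : List (UserState × Bool)) (x : UserState) :
    T * θ - B + h x ≤ U.expectedCost l π T H x := by
  induction T generalizing H x with
  | zero => simpa [expectedCost] using hB x
  | succ T ih =>
    have key : ∀ a, ((T + 1 : ℕ) : ℝ) * θ - B + h x ≤ U.stageCost l x a +
        U.expectNext x a (fun y => U.expectedCost l π T ((x, a) :: H) y) := fun a => by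
      have h1 := U.expectNext_mono hq0 hq1 x a fun y => ih ((x, a) :: H) y
      rw [expectNext_const_add] at h1
      have h2 := hbell x a
      rw [actionValue] at h2
      push_cast
      linarith
    have h1 := mul_le_mul_of_nonneg_left (key true) (π H x).2.1
    have h2 := mul_le_mul_of_nonneg_left (key false) (sub_nonneg.mpr (π H x).2.2)
    rw [expectedCost]
    linarith

/-- The history-dependent randomized policy given by a deterministic stationary one. -/
def stationary (g : UserState → Bool) : Policy := fun _ x => if g x then 1 else 0

theorem expectedCost_stationary_le (hq0 : 0 ≤ U.q) (hq1 : U.q ≤ 1) {l θ B : ℝ}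
    {h : UserState → ℝ} (hB : ∀ x, -B ≤ h x) {g : UserState → Bool}
    (hbell : ∀ x, U.actionValue l h x (g x) ≤ h x + θ) (T : ℕ)
    (H : List (UserState × Bool)) (x : UserState) :
    U.expectedCost l (stationary g) T H x ≤ T * θ + B + h x := by
  induction T generalizing H x with
  | zero => simp [expectedCost]; linarith [hB x]
  | succ T ih =>
    have h1 := U.expectNext_mono hq0 hq1 x (g x) fun y => ih ((x, g x) :: H) y
    rw [expectNext_const_add] at h1
    have h2 := hbell x
    rw [actionValue] at h2
    rw [expectedCost]
    cases hg : g x <;> rw [hg] at h1 h2 <;> simp [stationary, hg] <;> linarith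

theorem tendsto_average (θ b : ℝ) :
    Tendsto (fun T : ℕ => (((T * θ + b) / T : ℝ) : EReal)) atTop (𝓝 (θ : EReal)) := by
  refine (continuous_coe_real_ereal.tendsto θ).comp ?_
  have h : Tendsto (fun T : ℕ => θ + b / T) atTop (𝓝 (θ + 0)) :=
    tendsto_const_nhds.add (tendsto_const_div_atTop_nhds_zero_nat b)
  rw [add_zero] at h
  refine h.congr' ?_
  filter_upwards [eventually_gt_atTop 0] with T hT
  have : (T : ℝ) ≠ 0 := by positivity
  field_simp

/-- A bounded solution of the Bellman equation certifies the optimal average cost: summed over `T`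
slots, it bounds the cost of every policy from below, and the cost of a policy that attains the
minima from above, up to a constant independent of `T`. -/
theorem optimalCost_eq_of_bellman (hq0 : 0 ≤ U.q) (hq1 : U.q ≤ 1) {l θ B : ℝ} {h : UserState → ℝ}
    (hB : ∀ x, |h x| ≤ B)
    (hbell : ∀ x, h x + θ = min (U.actionValue l h x true) (U.actionValue l h x false))
    (x : UserState) : U.optimalCost l x = (θ : EReal) := by
  classical
  apply le_antisymm
  · let g : UserState → Bool := fun x =>
      decide (U.actionValue l h x true ≤ U.actionValue l h x false)
    have hg : ∀ x, U.actionValue l h x (g x) ≤ h x + θ := by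
      intro x
      rw [hbell x]
      by_cases hx : U.actionValue l h x true ≤ U.actionValue l h x false
      · simp [g, hx]
      · simp [g, hx, (not_le.mp hx).le]
    refine (iInf_le _ (stationary g)).trans ?_
    rw [averageCost, ← (tendsto_average θ (B + h x)).limsup_eq]
    refine limsup_le_limsup (Eventually.of_forall fun T => ?_)
    refine EReal.coe_le_coe_iff.mpr (div_le_div_of_nonneg_right ?_ T.cast_nonneg)
    rw [← add_assoc]
    exact U.expectedCost_stationary_le hq0 hq1 (fun y => (abs_le.mp (hB y)).1) hg T [] x
  · refine le_iInf fun π => ?_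
    rw [averageCost, ← (tendsto_average θ (-B + h x)).limsup_eq]
    refine limsup_le_limsup (Eventually.of_forall fun T => ?_)
    refine EReal.coe_le_coe_iff.mpr (div_le_div_of_nonneg_right ?_ T.cast_nonneg)
    rw [← add_assoc]
    refine U.le_expectedCost hq0 hq1 (fun y => (abs_le.mp (hB y)).2) (fun y a => ?_) π T [] x
    rw [hbell y]
    cases a
    · exact min_le_right _ _
    · exact min_le_left _ _

/-! ### Uniqueness of the relative cost -/

/-- The expectation of `h` over the request in a slot in which the age is `n`. -/
noncomputable def meanCost (h : UserState → ℝ) (n : ℕ+) : ℝ :=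
  U.q * h (n, true) + (1 - U.q) * h (n, false)

theorem actionValue_true (l : ℝ) (h : UserState → ℝ) (x : UserState) :
    U.actionValue l h x true = U.κ + l + U.meanCost h 1 := rfl

theorem actionValue_false (l : ℝ) (h : UserState → ℝ) (x : UserState) :
    U.actionValue l h x false = (if x.2 then U.Cav x.1 else 0) + U.meanCost h (x.1 + 1) := rfl

theorem abs_meanCost_le (hq0 : 0 ≤ U.q) (hq1 : U.q ≤ 1) {h : UserState → ℝ} {B : ℝ}
    (hB : ∀ x, |h x| ≤ B) (n : ℕ+) : |U.meanCost h n| ≤ B := by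
  have h1 := abs_le.mp (hB (n, true))
  have h2 := abs_le.mp (hB (n, false))
  have := sub_nonneg.mpr hq1
  rw [meanCost, abs_le]
  constructor <;> nlinarith

/-- The Bellman equation as a backward recursion in the age, for the mean cost relative to its
value just after a fetch. -/
theorem meanCost_recursion {l θ : ℝ} {h : UserState → ℝ}
    (hbell : ∀ x, h x + θ = min (U.actionValue l h x true) (U.actionValue l h x false)) (n : ℕ+) :
    U.meanCost h n - U.meanCost h 1 + θ =
      U.q * min (U.κ + l) (U.Cav n + (U.meanCost h (n + 1) - U.meanCost h 1)) +
        (1 - U.q) * min (U.κ + l) (U.meanCost h (n + 1) - U.meanCost h 1) := by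
  have h1 := hbell (n, true)
  have h2 := hbell (n, false)
  simp only [actionValue_true, actionValue_false, if_true, Bool.false_eq_true, if_false,
    zero_add] at h1 h2
  have e1 : min (U.κ + l) (U.Cav n + (U.meanCost h (n + 1) - U.meanCost h 1)) =
      h (n, true) + θ - U.meanCost h 1 := by
    rw [h1, ← min_sub_sub_right]
    congr 1 <;> ring
  have e2 : min (U.κ + l) (U.meanCost h (n + 1) - U.meanCost h 1) =
      h (n, false) + θ - U.meanCost h 1 := by
    rw [h2, ← min_sub_sub_right]
    congr 1
    ring
  rw [e1, e2]
  nth_rewrite 1 [meanCost]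
  ring

theorem abs_min_sub_min_le (a x y : ℝ) : |min a x - min a y| ≤ |x - y| := by
  simpa using abs_min_sub_min_le_max a x a y

/-- Two bounded solutions of the Bellman equation with the same average cost differ by a constant.
At high ages, where waiting through a request is never optimal, the backward recursion is a
contraction, so that two bounded solutions agree there; and it determines the solution at lower
ages. -/
theorem meanCost_sub_eq (hA : Admissible U.q U.Cav) {l θ : ℝ} {h h' : UserState → ℝ}
    (hb : ∃ B, ∀ x, |h x| ≤ B) (hb' : ∃ B, ∀ x, |h' x| ≤ B)
    (hbell : ∀ x, h x + θ = min (U.actionValue l h x true) (U.actionValue l h x false))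
    (hbell' : ∀ x, h' x + θ = min (U.actionValue l h' x true) (U.actionValue l h' x false))
    (n : ℕ+) : U.meanCost h n - U.meanCost h 1 = U.meanCost h' n - U.meanCost h' 1 := by
  obtain ⟨B, hB⟩ := hb
  obtain ⟨B', hB'⟩ := hb'
  have hq0 := hA.q_pos.le
  have hq1 := sub_nonneg.mpr hA.q_le_one
  have hrec := U.meanCost_recursion hbell
  have hrec' := U.meanCost_recursion hbell'
  have hG : ∀ n, |U.meanCost h n - U.meanCost h 1| ≤ 2 * B := fun n => by
    have h1 := abs_le.mp (U.abs_meanCost_le hq0 hA.q_le_one hB n)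
    have h2 := abs_le.mp (U.abs_meanCost_le hq0 hA.q_le_one hB 1)
    exact abs_le.mpr ⟨by linarith, by linarith⟩
  have hG' : ∀ n, |U.meanCost h' n - U.meanCost h' 1| ≤ 2 * B' := fun n => by
    have h1 := abs_le.mp (U.abs_meanCost_le hq0 hA.q_le_one hB' n)
    have h2 := abs_le.mp (U.abs_meanCost_le hq0 hA.q_le_one hB' 1)
    exact abs_le.mpr ⟨by linarith, by linarith⟩
  generalize hF : (fun n => U.meanCost h n - U.meanCost h 1) = F
  generalize hF' : (fun n => U.meanCost h' n - U.meanCost h' 1) = F'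
  simp only [funext_iff] at hF hF'
  simp only [hF, hF'] at hrec hrec' hG hG' ⊢
  obtain ⟨N, hN⟩ := eventually_atTop.mp
    (hA.tendsto.eventually_ge_atTop (U.κ + l + 2 * max B B'))
  have hcontr : ∀ n : ℕ+, N ≤ n → |F n - F' n| ≤ (1 - U.q) * |F (n + 1) - F' (n + 1)| := by
    intro n hn
    have h1 := hN n hn
    have h2 := (abs_le.mp (hG (n + 1))).1
    have h3 := (abs_le.mp (hG' (n + 1))).1
    have e1 := hrec n
    have e2 := hrec' n
    rw [min_eq_left (by linarith [le_max_left B B'])] at e1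
    rw [min_eq_left (by linarith [le_max_right B B'])] at e2
    have e3 : F n - F' n =
        (1 - U.q) * (min (U.κ + l) (F (n + 1)) - min (U.κ + l) (F' (n + 1))) := by linarith
    rw [e3, abs_mul, abs_of_nonneg hq1]
    exact mul_le_mul_of_nonneg_left (abs_min_sub_min_le _ _ _) hq1
  have hgeom : ∀ (k : ℕ) (n : ℕ+), N ≤ n → |F n - F' n| ≤ (1 - U.q) ^ k * (2 * B + 2 * B') := by
    intro k
    induction k with
    | zero =>
      intro n _
      have := abs_sub (F n) (F' n)
      linarith [hG n, hG' n]
    | succ k ih =>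
      intro n hn
      refine (hcontr n hn).trans ?_
      rw [pow_succ', mul_assoc]
      exact mul_le_mul_of_nonneg_left (ih (n + 1) (by push_cast; omega)) hq1
  have htail : ∀ n : ℕ+, N ≤ n → F n = F' n := by
    intro n hn
    have hlim : Tendsto (fun k : ℕ => (1 - U.q) ^ k * (2 * B + 2 * B')) atTop (𝓝 0) := by
      simpa using (tendsto_pow_atTop_nhds_zero_of_lt_one hq1 (by linarith [hA.q_pos])).mul_const
        (2 * B + 2 * B')
    have := ge_of_tendsto' hlim fun k => hgeom k n hn
    exact sub_eq_zero.mp (abs_nonpos_iff.mp this)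
  have hback : ∀ n : ℕ+, F (n + 1) = F' (n + 1) → F n = F' n := by
    intro n hn
    have e1 := hrec n
    have e2 := hrec' n
    rw [hn] at e1
    linarith
  have hdown : ∀ (k : ℕ) (n : ℕ+), N ≤ n + k → F n = F' n := by
    intro k
    induction k with
    | zero => exact fun n hn => htail n (by simpa using hn)
    | succ k ih => exact fun n hn => hback n (ih (n + 1) (by push_cast; omega))
  exact hdown N n (by omega)

theorem actionValue_sub_eq (hA : Admissible U.q U.Cav) {l θ θ' : ℝ} {h h' : UserState → ℝ}
    (hh : U.IsRelativeCost l θ h) (hh' : U.IsRelativeCost l θ' h') (x : UserState) :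
    U.actionValue l h x false - U.actionValue l h x true =
      U.actionValue l h' x false - U.actionValue l h' x true := by
  obtain rfl : θ = θ' := EReal.coe_injective ((hh.optimal x).symm.trans (hh'.optimal x))
  have := U.meanCost_sub_eq hA hh.bounded hh'.bounded hh.bellman hh'.bellman (x.1 + 1)
  simp only [actionValue_true, actionValue_false]
  linarith

end User

/-! ### The relative cost of an optimal threshold -/

/-- The expected cost, over one cycle between two fetches, of the policy with threshold `n` when
every slot is credited with `θ`. -/
noncomputable def excessCost (q : ℝ) (c : ℕ → ℝ) (m θ : ℝ) (n : ℕ) : ℝ :=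
  q * ∑ x ∈ Finset.Ico 1 n, c x + m - θ * (n + (1 - q) / q)

theorem excessCost_succ (q : ℝ) (c : ℕ → ℝ) (m θ : ℝ) {n : ℕ} (hn : 1 ≤ n) :
    excessCost q c m θ (n + 1) = excessCost q c m θ n + (q * c n - θ) := by
  rw [excessCost, excessCost, Finset.sum_Ico_succ_top hn]
  push_cast
  ring

namespace Admissible

variable {q : ℝ} {c : ℕ → ℝ}

theorem excessCost_eq (hA : Admissible q c) (m θ : ℝ) {n : ℕ} (hn : 1 ≤ n) :
    excessCost q c m θ n = (thresholdRatio q c m n - θ) * (n + (1 - q) / q) := by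
  rw [excessCost, thresholdRatio, sub_mul, div_mul_cancel₀ _ (hA.length_pos hn).ne']

theorem one_le_threshold (hA : Admissible q c) (m : ℝ) : 1 ≤ threshold q c m :=
  (hA.isGreatest_threshold m).1.1

theorem excessCost_threshold (hA : Admissible q c) (m : ℝ) :
    excessCost q c m (thresholdRatio q c m (threshold q c m)) (threshold q c m) = 0 := by
  rw [hA.excessCost_eq _ _ (hA.one_le_threshold m), sub_self, zero_mul]

theorem excessCost_nonneg (hA : Admissible q c) (m : ℝ) {n : ℕ} (hn : 1 ≤ n) :
    0 ≤ excessCost q c m (thresholdRatio q c m (threshold q c m)) n := by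
  rw [hA.excessCost_eq _ _ hn]
  exact mul_nonneg (sub_nonneg.mpr ((hA.isGreatest_threshold m).1.2 n hn)) (hA.length_pos hn).le

theorem excessCost_pos (hA : Admissible q c) {m : ℝ} {n : ℕ} (hn : 1 ≤ n)
    (h : criticalCharge q c n < m) :
    0 < excessCost q c m (thresholdRatio q c m (threshold q c m)) n := by
  rw [hA.excessCost_eq _ _ hn]
  exact mul_pos (sub_pos.mpr (((hA.isGreatest_threshold m).1.2 _ (Nat.le_succ_of_le hn)).trans_lt
    (hA.thresholdRatio_succ_lt hn h))) (hA.length_pos hn)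

/-- Below the optimal threshold, the expected cost of a slot is at most the optimal average. -/
theorem cost_le_thresholdRatio (hA : Admissible q c) {m : ℝ} {n : ℕ} (hn : 1 ≤ n)
    (h : n < threshold q c m) :
    q * c n ≤ thresholdRatio q c m (threshold q c m) := by
  obtain ⟨k, hk⟩ := Nat.exists_eq_add_of_lt h
  replace hk : threshold q c m = (n + k) + 1 := hk
  have hk1 : 1 ≤ n + k := Nat.le_add_right_of_le hn
  have h1 := hA.excessCost_threshold m
  have h2 := hA.excessCost_nonneg m hk1
  have h3 := hA.mono (Nat.le_add_right n k)
  have h4 := mul_le_mul_of_nonneg_left h3 hA.q_pos.le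
  generalize thresholdRatio q c m (threshold q c m) = θ at *
  rw [hk, excessCost_succ _ _ _ _ hk1] at h1
  linarith

/-- From the optimal threshold on, the expected cost of a slot exceeds the optimal average. -/
theorem thresholdRatio_lt_cost (hA : Admissible q c) {m : ℝ} {n : ℕ}
    (h : threshold q c m ≤ n) :
    thresholdRatio q c m (threshold q c m) < q * c n := by
  have hf := hA.one_le_threshold m
  have h1 := hA.excessCost_threshold m
  have h2 : 0 < excessCost q c m (thresholdRatio q c m (threshold q c m))
      (threshold q c m + 1) := by
    rw [hA.excessCost_eq _ _ (Nat.le_succ_of_le hf)]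
    refine mul_pos (sub_pos.mpr (hA.thresholdRatio_lt_succ hf ?_))
      (hA.length_pos (Nat.le_succ_of_le hf))
    exact not_le.mp fun h => lt_irrefl _ ((hA.lt_threshold_iff hf).mpr h)
  rw [excessCost_succ _ _ _ _ hf, h1] at h2
  have h4 := mul_le_mul_of_nonneg_left (hA.mono h) hA.q_pos.le
  linarith

end Admissible

namespace User

variable (U : User)

/-- The charge `U.κ + l` for a fetch at which the optimal action in a state changes from fetching to
waiting. -/
noncomputable def switchingCharge (x : UserState) : ℝ :=
  if x.2 then criticalCharge U.q U.Cav x.1 else 0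

/-- The action values of the zero relative cost, which is the right one if the charge `U.κ + l` is
negative: fetching in every slot is then optimal. -/
theorem actionValue_zero (hA : Admissible U.q U.Cav) (l : ℝ) (x : UserState) :
    U.actionValue l (fun _ => 0) x true = U.κ + l ∧
      0 ≤ U.actionValue l (fun _ => 0) x false := by
  have := hA.nonneg x.1
  simp only [actionValue_true, actionValue_false, meanCost]
  constructor
  · ring
  · split_ifs <;> linarith

/-- The mean over the request of the relative cost, at age `n`, of the policy that fetches at the
first request from the age `threshold U.q U.Cav m` on. It is normalized to vanish at age `1`, and
constant from the threshold on. -/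
noncomputable def thresholdMeanCost (m : ℝ) (n : ℕ) : ℝ :=
  m - thresholdRatio U.q U.Cav m (threshold U.q U.Cav m) / U.q -
    excessCost U.q U.Cav m (thresholdRatio U.q U.Cav m (threshold U.q U.Cav m))
      (min n (threshold U.q U.Cav m))

/-- The relative cost of the policy that fetches at the first request from the age
`threshold U.q U.Cav m` on, for a nonnegative charge `m` per fetch: the Bellman equation expresses
it by the mean relative cost at the next age. -/
noncomputable def thresholdCost (m : ℝ) (x : UserState) : ℝ :=
  (if x.2 then min m (U.Cav x.1 + U.thresholdMeanCost m (x.1 + 1))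
    else U.thresholdMeanCost m (x.1 + 1)) -
    thresholdRatio U.q U.Cav m (threshold U.q U.Cav m)

theorem thresholdRatio_threshold_nonneg (hA : Admissible U.q U.Cav) {m : ℝ} (hm : 0 ≤ m) :
    0 ≤ thresholdRatio U.q U.Cav m (threshold U.q U.Cav m) :=
  div_nonneg (add_nonneg (mul_nonneg hA.q_pos.le (Finset.sum_nonneg fun _ _ => hA.nonneg _)) hm)
    (hA.length_pos (hA.one_le_threshold m)).le

theorem thresholdRatio_threshold_pos (hA : Admissible U.q U.Cav) {m : ℝ} (hm : 0 < m) :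
    0 < thresholdRatio U.q U.Cav m (threshold U.q U.Cav m) :=
  div_pos (add_pos_of_nonneg_of_pos
    (mul_nonneg hA.q_pos.le (Finset.sum_nonneg fun _ _ => hA.nonneg _)) hm)
    (hA.length_pos (hA.one_le_threshold m))

theorem thresholdMeanCost_le (hA : Admissible U.q U.Cav) (m : ℝ) {n : ℕ} (hn : 1 ≤ n) :
    U.thresholdMeanCost m n ≤
      m - thresholdRatio U.q U.Cav m (threshold U.q U.Cav m) / U.q :=
  sub_le_self _ (hA.excessCost_nonneg m (le_min hn (hA.one_le_threshold m)))

theorem thresholdMeanCost_one (hA : Admissible U.q U.Cav) (m : ℝ) :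
    U.thresholdMeanCost m 1 = 0 := by
  have := hA.q_pos.ne'
  rw [thresholdMeanCost, min_eq_left (hA.one_le_threshold m), excessCost]
  simp only [Finset.Ico_self, Finset.sum_empty]
  field_simp
  push_cast
  ring

theorem thresholdMeanCost_of_le (hA : Admissible U.q U.Cav) {m : ℝ} {n : ℕ}
    (h : threshold U.q U.Cav m ≤ n) :
    U.thresholdMeanCost m n =
      m - thresholdRatio U.q U.Cav m (threshold U.q U.Cav m) / U.q := by
  rw [thresholdMeanCost, min_eq_right h, hA.excessCost_threshold, sub_zero]

theorem thresholdMeanCost_succ_of_lt {m : ℝ} {n : ℕ} (hn : 1 ≤ n)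
    (h : n < threshold U.q U.Cav m) :
    U.thresholdMeanCost m (n + 1) = U.thresholdMeanCost m n - U.q * U.Cav n +
      thresholdRatio U.q U.Cav m (threshold U.q U.Cav m) := by
  rw [thresholdMeanCost, thresholdMeanCost, min_eq_left (Nat.succ_le_of_lt h), min_eq_left h.le,
    excessCost_succ _ _ _ _ hn]
  ring

/-- Waiting through a request is at least as good as fetching below the threshold. -/
theorem cost_add_thresholdMeanCost_le (hA : Admissible U.q U.Cav) {m : ℝ} {n : ℕ} (hn : 1 ≤ n)
    (h : n < threshold U.q U.Cav m) : U.Cav n + U.thresholdMeanCost m (n + 1) ≤ m := by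
  have h1 := hA.cost_le_thresholdRatio hn h
  have h2 := U.thresholdMeanCost_le hA m (Nat.le_succ_of_le hn)
  have h3 : U.Cav n ≤ thresholdRatio U.q U.Cav m (threshold U.q U.Cav m) / U.q :=
    (le_div_iff₀' hA.q_pos).mpr h1
  linarith

theorem lt_cost_add_thresholdMeanCost (hA : Admissible U.q U.Cav) {m : ℝ} {n : ℕ}
    (h : threshold U.q U.Cav m ≤ n) : m < U.Cav n + U.thresholdMeanCost m (n + 1) := by
  have h1 := (div_lt_iff₀' hA.q_pos).mpr (hA.thresholdRatio_lt_cost h)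
  rw [U.thresholdMeanCost_of_le hA (Nat.le_succ_of_le h)]
  linarith

/-- Above the critical charge, waiting through a request is strictly better than fetching. -/
theorem cost_add_thresholdMeanCost_lt (hA : Admissible U.q U.Cav) {m : ℝ} {n : ℕ} (hn : 1 ≤ n)
    (h : criticalCharge U.q U.Cav n < m) : U.Cav n + U.thresholdMeanCost m (n + 1) < m := by
  have hlt := (hA.lt_threshold_iff hn).mpr h.le
  have h1 := hA.cost_le_thresholdRatio hn hlt
  have h2 := hA.excessCost_pos hn h
  have h3 : U.Cav n ≤ thresholdRatio U.q U.Cav m (threshold U.q U.Cav m) / U.q :=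
    (le_div_iff₀' hA.q_pos).mpr h1
  have h4 := hA.excessCost_nonneg m (Nat.le_succ_of_le hn)
  rw [thresholdMeanCost, min_eq_left (Nat.succ_le_of_lt hlt)]
  -- A tie needs both the slot cost to equal the average and the excess cost at `n` to vanish.
  rcases h1.lt_or_eq with h5 | h5
  · have h6 := (lt_div_iff₀' hA.q_pos).mpr h5
    linarith
  · rw [excessCost_succ _ _ _ _ hn, h5, sub_self, add_zero]
    linarith

theorem meanCost_thresholdCost (hA : Admissible U.q U.Cav) (m : ℝ) (n : ℕ+) :
    U.meanCost (U.thresholdCost m) n = U.thresholdMeanCost m n := by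
  have hq := hA.q_pos.ne'
  simp only [meanCost, thresholdCost, if_true, Bool.false_eq_true, if_false]
  rcases lt_or_ge (n : ℕ) (threshold U.q U.Cav m) with h | h
  · rw [min_eq_right (U.cost_add_thresholdMeanCost_le hA n.pos h),
      U.thresholdMeanCost_succ_of_lt n.pos h]
    ring
  · rw [min_eq_left (U.lt_cost_add_thresholdMeanCost hA h).le,
      U.thresholdMeanCost_of_le hA (Nat.le_succ_of_le h), U.thresholdMeanCost_of_le hA h]
    field_simp
    ring

theorem actionValue_thresholdCost_true (hA : Admissible U.q U.Cav) (l : ℝ) (x : UserState) :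
    U.actionValue l (U.thresholdCost (U.κ + l)) x true = U.κ + l := by
  rw [actionValue_true, U.meanCost_thresholdCost hA, PNat.one_coe, U.thresholdMeanCost_one hA,
    add_zero]

theorem actionValue_thresholdCost_false (hA : Admissible U.q U.Cav) (l : ℝ) (x : UserState) :
    U.actionValue l (U.thresholdCost (U.κ + l)) x false =
      (if x.2 then U.Cav x.1 else 0) + U.thresholdMeanCost (U.κ + l) (x.1 + 1) := by
  rw [actionValue_false, U.meanCost_thresholdCost hA, PNat.add_coe, PNat.one_coe]

theorem exists_abs_thresholdCost_le (hA : Admissible U.q U.Cav) (m : ℝ) :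
    ∃ B, ∀ x, |U.thresholdCost m x| ≤ B := by
  set θ := thresholdRatio U.q U.Cav m (threshold U.q U.Cav m) with hθ
  obtain ⟨M, hM⟩ := ((Set.finite_Iic (threshold U.q U.Cav m)).image fun n =>
    |m - θ / U.q - excessCost U.q U.Cav m θ n|).bddAbove
  have hH : ∀ n, |U.thresholdMeanCost m n| ≤ M := fun n =>
    hM ⟨min n (threshold U.q U.Cav m), Set.mem_Iic.mpr (min_le_right _ _), rfl⟩
  refine ⟨|m| + M + |θ|, fun x => ?_⟩
  have h1 := abs_le.mp (hH (x.1 + 1))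
  have h2 := hA.nonneg x.1
  rw [thresholdCost, ← hθ]
  have h3 := neg_abs_le m
  have h4 := le_abs_self m
  have h5 := neg_abs_le θ
  have h6 := le_abs_self θ
  have h7 := abs_nonneg m
  have h8 := (abs_nonneg _).trans (hH 0)
  rw [abs_le]
  split_ifs
  · constructor
    · have := le_min (show -(|m| + M) ≤ m by linarith)
        (show -(|m| + M) ≤ U.Cav x.1 + U.thresholdMeanCost m (x.1 + 1) by linarith)
      linarith
    · have := min_le_left m (U.Cav x.1 + U.thresholdMeanCost m (x.1 + 1))
      linarith
  · constructor <;> linarith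

theorem bellman_thresholdCost (hA : Admissible U.q U.Cav) {l : ℝ} (hm : 0 ≤ U.κ + l)
    (x : UserState) :
    U.thresholdCost (U.κ + l) x +
        thresholdRatio U.q U.Cav (U.κ + l) (threshold U.q U.Cav (U.κ + l)) =
      min (U.actionValue l (U.thresholdCost (U.κ + l)) x true)
        (U.actionValue l (U.thresholdCost (U.κ + l)) x false) := by
  rw [U.actionValue_thresholdCost_true hA, U.actionValue_thresholdCost_false hA, thresholdCost,
    sub_add_cancel]
  split_ifs
  · rfl
  · have h1 := U.thresholdMeanCost_le hA (U.κ + l) (n := x.1 + 1) (Nat.le_add_left _ _)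
    have h2 := div_nonneg (U.thresholdRatio_threshold_nonneg hA hm) hA.q_pos.le
    rw [min_eq_right (by linarith), zero_add]

/-- The single-user problem has a relative cost, and the optimal actions in a state are decided by
comparing the charge for a fetch with the switching charge. -/
theorem exists_isRelativeCost (hA : Admissible U.q U.Cav) (l : ℝ) :
    ∃ θ h, U.IsRelativeCost l θ h ∧ ∀ x,
      (U.switchingCharge x ≤ U.κ + l → U.actionValue l h x false ≤ U.actionValue l h x true) ∧
      (U.switchingCharge x < U.κ + l → U.actionValue l h x false < U.actionValue l h x true) ∧
      (U.κ + l < U.switchingCharge x →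
        U.actionValue l h x true < U.actionValue l h x false) := by
  have hq0 := hA.q_pos.le
  have hq1 := hA.q_le_one
  rcases lt_or_ge (U.κ + l) 0 with hm | hm
  · have hval := U.actionValue_zero hA l
    have hbell : ∀ x, (0 : ℝ) + (U.κ + l) = min (U.actionValue l (fun _ => 0) x true)
        (U.actionValue l (fun _ => 0) x false) := fun x => by
      rw [(hval x).1, min_eq_left (hm.le.trans (hval x).2), zero_add]
    refine ⟨U.κ + l, fun _ => 0, ⟨?_, ⟨0, by simp⟩, hbell⟩, fun x => ?_⟩
    · exact U.optimalCost_eq_of_bellman hq0 hq1 (B := 0) (h := fun _ => 0) (by simp) hbell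
    · have h0 : 0 ≤ U.switchingCharge x := by
        rw [switchingCharge]
        split_ifs
        exacts [hA.criticalCharge_nonneg x.1.pos, le_rfl]
      obtain ⟨h1, h2⟩ := hval x
      exact ⟨fun h => by linarith, fun h => by linarith, fun _ => by linarith⟩
  · obtain ⟨B, hB⟩ := U.exists_abs_thresholdCost_le hA (U.κ + l)
    have hbell := U.bellman_thresholdCost hA hm
    refine ⟨_, U.thresholdCost (U.κ + l),
      ⟨U.optimalCost_eq_of_bellman hq0 hq1 hB hbell, ⟨B, hB⟩, hbell⟩, fun x => ?_⟩
    rw [U.actionValue_thresholdCost_true hA, U.actionValue_thresholdCost_false hA, switchingCharge]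
    have hx : 1 ≤ (x.1 : ℕ) := x.1.pos
    split_ifs
    · refine ⟨fun h => ?_, U.cost_add_thresholdMeanCost_lt hA hx, fun h => ?_⟩
      · exact U.cost_add_thresholdMeanCost_le hA hx ((hA.lt_threshold_iff hx).mpr h)
      · exact U.lt_cost_add_thresholdMeanCost hA
          (not_lt.mp fun h' => not_le.mpr h ((hA.lt_threshold_iff hx).mp h'))
    · have h1 := U.thresholdMeanCost_le hA (U.κ + l) (n := x.1 + 1) (Nat.le_add_left _ _)
      have h2 := div_nonneg (U.thresholdRatio_threshold_nonneg hA hm) hA.q_pos.le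
      refine ⟨fun _ => by linarith, fun h => ?_, fun h => by linarith⟩
      have h3 := div_pos (U.thresholdRatio_threshold_pos hA h) hA.q_pos
      linarith

/-! ### The Whittle index -/

theorem exists_isOptimalPolicy (hA : Admissible U.q U.Cav) (l : ℝ) :
    ∃ π, U.IsOptimalPolicy l π ∧ ∀ x, U.switchingCharge x ≤ U.κ + l → π x = false := by
  classical
  obtain ⟨θ, h, hh, hsw⟩ := U.exists_isRelativeCost hA l
  refine ⟨fun x => decide (U.actionValue l h x true < U.actionValue l h x false),
    ⟨θ, h, hh, fun x => ?_⟩, fun x hx => decide_eq_false (not_lt.mpr ((hsw x).1 hx))⟩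
  by_cases hx : U.actionValue l h x true < U.actionValue l h x false
  · simp [hx, hx.le]
  · simp [hx, not_lt.mp hx]

/-- All optimal policies wait in `x` if the charge exceeds the switching charge, and all fetch if it
is smaller. By uniqueness of the relative cost, this does not depend on the solution of the Bellman
equation that an optimal policy refers to. -/
theorem IsOptimalPolicy.apply_eq {U : User} (hA : Admissible U.q U.Cav) {l : ℝ}
    {π : UserState → Bool} (hπ : U.IsOptimalPolicy l π) (x : UserState) :
    (U.switchingCharge x < U.κ + l → π x = false) ∧
      (U.κ + l < U.switchingCharge x → π x = true) := by
  obtain ⟨θ, h, hh, hmin⟩ := hπ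
  obtain ⟨θ', h', hh', hsw⟩ := U.exists_isRelativeCost hA l
  have hsub := U.actionValue_sub_eq hA hh hh' x
  have hx := hmin x
  obtain ⟨-, hlt, hgt⟩ := hsw x
  refine ⟨fun hl => ?_, fun hl => ?_⟩
  · by_contra hne
    rw [Bool.not_eq_false] at hne
    have h1 := hlt hl
    rw [hne] at hx
    have h2 := hx.le.trans (min_le_right _ _)
    linarith
  · by_contra hne
    rw [Bool.not_eq_true] at hne
    have h1 := hgt hl
    rw [hne] at hx
    have h2 := hx.le.trans (min_le_left _ _)
    linarith

theorem setOf_mem_passiveSet (hA : Admissible U.q U.Cav) (x : UserState) :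
    {l : ℝ | x ∈ U.passiveSet l} = Set.Ici (U.switchingCharge x - U.κ) := by
  ext l
  rw [Set.mem_Ici, sub_le_iff_le_add']
  constructor
  · rintro ⟨π, hπ, hx⟩
    by_contra! hl
    have := (hπ.apply_eq hA x).2 hl
    simp [hx] at this
  · intro hl
    obtain ⟨π, hπ, hx⟩ := U.exists_isOptimalPolicy hA l
    exact ⟨π, hπ, hx x hl⟩

theorem whittleIndex_eq (hA : Admissible U.q U.Cav) (x : UserState) :
    U.whittleIndex x = U.switchingCharge x - U.κ := by
  rw [whittleIndex, U.setOf_mem_passiveSet hA, csInf_Ici]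

theorem isGLB_setOf_eq_false (hA : Admissible U.q U.Cav) {π : ℝ → UserState → Bool}
    (hπ : ∀ l, U.IsOptimalPolicy l (π l)) (x : UserState) :
    IsGLB {l : ℝ | π l x = false} (U.whittleIndex x) := by
  rw [U.whittleIndex_eq hA]
  refine isGLB_of_Ioi_subset_of_subset_Ici (fun l hl => ?_) fun l hl => ?_
  · exact ((hπ l).apply_eq hA x).1 (sub_lt_iff_lt_add'.mp hl)
  · rw [← U.setOf_mem_passiveSet hA]
    exact ⟨π l, hπ l, hl⟩

end User

theorem sum_whittleIndex_user {N : ℕ} {p Cf : ℝ} {q : Fin N → ℝ} {C : Fin N → ℕ → ℝ}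
    (hA : ∀ i, Admissible (q i) (avgAgeCost p (C i))) {α : Fin N → ℝ} (hα : IsCostSplit α)
    (τ : ℕ+) (s : Fin N → Bool) :
    ∑ i, (user p Cf q C α i).whittleIndex (τ, s i) =
      ∑ i, (if s i then criticalCharge (q i) (avgAgeCost p (C i)) τ else 0) - Cf := by
  rw [Finset.sum_congr rfl fun i _ => (user p Cf q C α i).whittleIndex_eq (hA i) (τ, s i),
    Finset.sum_sub_distrib]
  simp only [User.switchingCharge, user]
  rw [← Finset.sum_mul, hα.2, one_mul]

end WhittleAge

theorem mainTheorem4 (N : ℕ) (p Cf : ℝ) (hp : 0 < p ∧ p ≤ 1)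
    (q : Fin N → ℝ) (hq : ∀ i, 0 < q i ∧ q i ≤ 1)
    (C : Fin N → ℕ → ℝ) (hC : ∀ i, WhittleAge.IsAgeCost (C i)) :
    -- `f_i` is the largest minimizer and `g_i` its generalized inverse, the minimum being attained;
    -- every other choice of minimizers has the same generalized inverse, as an infimum
    (∀ i, (∀ m : ℝ, IsGreatest (WhittleAge.thresholdArgmin (q i) (WhittleAge.avgAgeCost p (C i)) m)
          (WhittleAge.threshold (q i) (WhittleAge.avgAgeCost p (C i)) m)) ∧
        ∀ τ : ℕ+,
          IsLeast {m : ℝ | (τ : ℕ) < WhittleAge.threshold (q i) (WhittleAge.avgAgeCost p (C i)) m}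
            (WhittleAge.thresholdInv (q i) (WhittleAge.avgAgeCost p (C i)) τ) ∧
          ∀ f : ℝ → ℕ,
            (∀ m, f m ∈ WhittleAge.thresholdArgmin (q i) (WhittleAge.avgAgeCost p (C i)) m) →
            IsGLB {m : ℝ | (τ : ℕ) < f m}
              (WhittleAge.thresholdInv (q i) (WhittleAge.avgAgeCost p (C i)) τ)) ∧
    -- the Whittle indices
    (∀ α : Fin N → ℝ, WhittleAge.IsCostSplit α → ∀ i,
      (∀ l : ℝ, ∃ π, (WhittleAge.user p Cf q C α i).IsOptimalPolicy l π) ∧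
      ∀ τ : ℕ+,
        (∀ s : Bool,
          IsLeast {l : ℝ | (τ, s) ∈ (WhittleAge.user p Cf q C α i).passiveSet l}
            ((WhittleAge.user p Cf q C α i).whittleIndex (τ, s)) ∧
          -- whatever the rule that breaks ties between optimal actions
          ∀ π : ℝ → WhittleAge.UserState → Bool,
            (∀ l, (WhittleAge.user p Cf q C α i).IsOptimalPolicy l (π l)) →
            IsGLB {l : ℝ | π l (τ, s) = false}
              ((WhittleAge.user p Cf q C α i).whittleIndex (τ, s))) ∧
        (WhittleAge.user p Cf q C α i).whittleIndex (τ, true) =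
          WhittleAge.thresholdInv (q i) (WhittleAge.avgAgeCost p (C i)) τ - α i * Cf ∧
        (WhittleAge.user p Cf q C α i).whittleIndex (τ, false) = -(α i * Cf)) ∧
    -- independence of the cost split
    (∀ α β : Fin N → ℝ, WhittleAge.IsCostSplit α → WhittleAge.IsCostSplit β →
      (∀ (τ : ℕ+) (s : Fin N → Bool),
        ∑ i, (WhittleAge.user p Cf q C α i).whittleIndex (τ, s i) =
          ∑ i, (WhittleAge.user p Cf q C β i).whittleIndex (τ, s i)) ∧
      WhittleAge.whittlePolicy (WhittleAge.user p Cf q C α) =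
        WhittleAge.whittlePolicy (WhittleAge.user p Cf q C β)) := by
  have hA : ∀ i, WhittleAge.Admissible (q i) (WhittleAge.avgAgeCost p (C i)) := fun i =>
    ⟨(hq i).1, (hq i).2, WhittleAge.avgAgeCost_nonneg hp.1.le hp.2 (hC i).nonneg,
      WhittleAge.monotone_avgAgeCost hp.1.le hp.2 (hC i).mono,
      (hC i).tendsto_avgAgeCost hp.1 hp.2⟩
  refine ⟨fun i => ⟨(hA i).isGreatest_threshold, fun τ => ?_⟩, fun α _ i => ?_,
    fun α β hα hβ => ?_⟩
  · have hτ : 1 ≤ (τ : ℕ) := τ.pos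
    rw [(hA i).thresholdInv_eq hτ, (hA i).setOf_lt_threshold hτ]
    refine ⟨isLeast_Ici, fun f hf => WhittleAge.isGLB_of_Ioi_subset_of_subset_Ici
      (fun m hm => (hA i).lt_of_mem_thresholdArgmin hm (hf m)) fun m hm => ?_⟩
    exact ((hA i).lt_threshold_iff hτ).mp (hm.trans_le (((hA i).isGreatest_threshold m).2 (hf m)))
  · have hU : WhittleAge.Admissible (WhittleAge.user p Cf q C α i).q
        (WhittleAge.user p Cf q C α i).Cav := hA i
    refine ⟨fun l => ?_, fun τ => ⟨fun s => ⟨?_, fun π hπ => ?_⟩, ?_, ?_⟩⟩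
    · obtain ⟨π, hπ, -⟩ := WhittleAge.User.exists_isOptimalPolicy _ hU l
      exact ⟨π, hπ⟩
    · rw [WhittleAge.User.whittleIndex_eq _ hU, WhittleAge.User.setOf_mem_passiveSet _ hU]
      exact isLeast_Ici
    · exact WhittleAge.User.isGLB_setOf_eq_false _ hU hπ (τ, s)
    · rw [WhittleAge.User.whittleIndex_eq _ hU, (hA i).thresholdInv_eq τ.pos]
      rfl
    · rw [WhittleAge.User.whittleIndex_eq _ hU]
      exact zero_sub _
  · have hsum : ∀ (τ : ℕ+) (s : Fin N → Bool),
        ∑ i, (WhittleAge.user p Cf q C α i).whittleIndex (τ, s i) =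
          ∑ i, (WhittleAge.user p Cf q C β i).whittleIndex (τ, s i) := fun τ s =>
      (WhittleAge.sum_whittleIndex_user hA hα τ s).trans
        (WhittleAge.sum_whittleIndex_user hA hβ τ s).symm
    refine ⟨hsum, ?_⟩
    funext τ s
    simp only [WhittleAge.whittlePolicy, hsum τ s]
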